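/- Let $\mathbb{D}=\{z\in\mathbb{C}:|z|<1\}$ and $\alpha\in(0,1/2)$. Let $h$ be analytic in $\mathbb{D}$ with $h(0)=0$, $h'(0)=1$, $h'(z)\neq 0$ for all $z\in\mathbb{D}$, and $$\operatorname{Re}\left(1+\frac{zh''(z)}{h'(z)}\right)>1-\frac{\alpha}{2}\qquad\text{for all } z\in\mathbb{D}$$ (that is, $h\in\mathcal{F}(\alpha)$). Let $g$ be analytic in $\mathbb{D}$ and suppose that the harmonic mapping $f=h+\overline{g}$ is sense-preserving in $\mathbb{D}$, i.e. its Jacobian $|h'|^2-|g'|^2$ is positive in $\mathbb{D}$. If the dilatation $\omega=g'/h'$ satisfies $$|\omega(z)|\le 1-\alpha|z|(1+|z|)\qquad\text{for all } z\in\mathbb{D},$$ then $f$ is univalent (injective) in $\mathbb{D}$. -/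

import Mathlib

open scoped ComplexConjugate

/-- The open unit disk `𝔻` in `ℂ`. -/
def unitDisk : Set ℂ := Metric.ball 0 1

/-- The class `𝒜`: functions analytic in `𝔻` with `h 0 = 0` and `h' 0 = 1`. Functions are total on
`ℂ`; only their values on `𝔻` matter. -/
structure ClassA (h : ℂ → ℂ) : Prop where
  analytic : AnalyticOnNhd ℂ h unitDisk
  map_zero : h 0 = 0
  deriv_zero : deriv h 0 = 1

/-- The family `ℱ(α)` of locally univalent (that is, `h' ≠ 0` in `𝔻`) functions `h ∈ 𝒜` such that
`Re (1 + z h''(z) / h'(z)) > 1 - α / 2` for all `z ∈ 𝔻`. -/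
structure ClassF (α : ℝ) (h : ℂ → ℂ) : Prop where
  classA : ClassA h
  deriv_ne_zero : ∀ z ∈ unitDisk, deriv h z ≠ 0
  re_gt : ∀ z ∈ unitDisk, 1 - α / 2 < (1 + z * deriv (deriv h) z / deriv h z).re

/-- The harmonic mapping `f = h + conj g` with analytic part `h` and co-analytic part `g`. -/
noncomputable def harmonicMap (h g : ℂ → ℂ) : ℂ → ℂ := fun z => h z + conj (g z)

/-- The Jacobian `|h'|² - |g'|²` of `f = h + conj g`. -/
noncomputable def harmonicJacobian (h g : ℂ → ℂ) (z : ℂ) : ℝ :=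
  ‖deriv h z‖ ^ 2 - ‖deriv g z‖ ^ 2

/-- `f = h + conj g` is sense-preserving in `𝔻`: its Jacobian is positive there. -/
def SensePreserving (h g : ℂ → ℂ) : Prop :=
  ∀ z ∈ unitDisk, 0 < harmonicJacobian h g z

/-- The dilatation `ω = g' / h'` of `f = h + conj g`. -/
noncomputable def dilatation (h g : ℂ → ℂ) (z : ℂ) : ℂ := deriv g z / deriv h z

/-- `f` is univalent (injective) in `𝔻`. -/
def UnivalentInDisk (f : ℂ → ℂ) : Prop := Set.InjOn f unitDisk

/-! Univalence follows from `Re h' > |g'|`, a Noshiro–Warschawski criterion, so the point is to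
control `arg h'`. Let `h' = exp L` with `L 0 = 0` and put `l = -L / α`. The `ℱ(α)` condition becomes
`Re (z l') < 1/2`, and Jack's lemma then confines `exp l` to the disk `|k - 1| ≤ |z|`. Hence `|Im l|
≤ arcsin |z| ≤ π |z| / 2`, which bounds `Im L`, and `Re h' = |h'| cos (Im L)` exceeds the assumed
bound on `|g'|`. -/

open Metric in
/-- **Jack's lemma**: if `w` is holomorphic with `w 0 = 0` and `‖w‖` attains its maximum over the
closed disk of radius `‖z‖` at `z`, then `z w'(z)` is a real multiple at least `1` of `w z`. -/
theorem jack_lemma {w : ℂ → ℂ} {z w' : ℂ} (hd : DifferentiableOn ℂ w (ball 0 ‖z‖))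
    (hw' : HasDerivAt w w' z) (hw0 : w 0 = 0) (hwz : w z ≠ 0)
    (hmax : ∀ x ∈ closedBall (0 : ℂ) ‖z‖, ‖w x‖ ≤ ‖w z‖) :
    ∃ m : ℝ, 1 ≤ m ∧ z * w' = m * w z := by
  have hz : z ≠ 0 := fun h => hwz (h ▸ hw0)
  have hr : 0 < ‖z‖ := norm_pos_iff.2 hz
  have hM : 0 < ‖w z‖ := norm_pos_iff.2 hwz
  have schwarz : ∀ t : ℝ, 0 ≤ t → t < 1 → ‖w (z * t)‖ ≤ ‖w z‖ * t := by
    intro t h0 h1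
    have hnorm : ‖z * (t : ℂ)‖ = ‖z‖ * t := by simp [abs_of_nonneg h0]
    have := Complex.dist_le_div_mul_dist_of_mapsTo_ball (z := z * t) (R₂ := ‖w z‖) hd
      (fun x hx => by
        rw [hw0, mem_closedBall_zero_iff]
        exact hmax x (ball_subset_closedBall hx))
      (by rw [mem_ball_zero_iff, hnorm]; nlinarith)
    rw [hw0, dist_zero_right, dist_zero_right, hnorm] at this
    calc _ ≤ _ := this
      _ = _ := by field_simp
  have radial : ‖w z‖ ^ 2 ≤ inner ℝ (w z) (z * w') := by
    have hc : HasDerivAt (fun t : ℝ => w (z * t)) (z * w') 1 := by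
      have h1 : HasDerivAt (fun t : ℝ => z * (t : ℂ)) z 1 := by
        simpa using (Complex.ofRealCLM.hasDerivAt (x := (1 : ℝ))).const_mul z
      have h2 : HasDerivAt w w' (z * ((1 : ℝ) : ℂ)) := by simpa using hw'
      have h3 := h2.comp (1 : ℝ) h1
      rwa [mul_comm] at h3
    -- By Schwarz, `‖w (z t)‖² - ‖w z‖² t²` is nonpositive for `0 < t < 1` and vanishes at `t = 1`,
    -- so its derivative there is nonnegative.
    have hP := (hc.norm_sq.sub (((hasDerivAt_id (1 : ℝ)).pow 2).const_mul (‖w z‖ ^ 2)))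
    have hs := (hasDerivAt_iff_tendsto_slope.1 hP).mono_left
      (nhdsWithin_mono (1 : ℝ) (fun x (hx : x ∈ Set.Iio (1 : ℝ)) => ne_of_lt hx))
    have hpos := ge_of_tendsto (b := 0) hs (by
      filter_upwards [Ioo_mem_nhdsLT (show (0 : ℝ) < 1 by norm_num)] with t ht
      have h1 := schwarz t ht.1.le ht.2
      have h2 : ‖w (z * t)‖ ^ 2 ≤ ‖w z‖ ^ 2 * t ^ 2 := by
        rw [← mul_pow]; gcongr
      rw [slope_def_field]
      apply div_nonneg_of_nonpos
      · simp; linarith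
      · linarith [ht.2])
    simp at hpos
    simp only [Complex.inner]
    simp
    linarith
  -- Along the circle through `z` the norm of `w` peaks at `z`; the vanishing tangential derivative
  -- makes `z w' conj (w z)` real.
  have angular : inner ℝ (w z) (z * w' * Complex.I) = 0 := by
    have hc : HasDerivAt (fun t : ℝ => w (z * Complex.exp (t * Complex.I)))
        (z * w' * Complex.I) 0 := by
      have h1 : HasDerivAt (fun t : ℝ => z * Complex.exp (t * Complex.I)) (z * Complex.I) 0 := by
        simpa using
          (((Complex.ofRealCLM.hasDerivAt (x := (0 : ℝ))).mul_const Complex.I).cexp).const_mul z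
      have h2 : HasDerivAt w w' (z * Complex.exp (((0 : ℝ) : ℂ) * Complex.I)) := by simpa using hw'
      have := h2.comp (0 : ℝ) h1
      rwa [mul_left_comm, ← mul_assoc] at this
    have hloc : IsLocalMax (fun t : ℝ => ‖w (z * Complex.exp (t * Complex.I))‖ ^ 2) 0 := by
      refine Filter.Eventually.of_forall fun t => ?_
      have := hmax (z * Complex.exp (t * Complex.I))
        (by simp [Complex.norm_exp_ofReal_mul_I])
      simpa using pow_le_pow_left₀ (norm_nonneg _) this 2
    have := hloc.hasDerivAt_eq_zero hc.norm_sq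
    simpa using this
  refine ⟨inner ℝ (w z) (z * w') / ‖w z‖ ^ 2, by rwa [one_le_div (by positivity)], ?_⟩
  have hsq : ((‖w z‖ ^ 2 : ℝ) : ℂ) = w z * conj (w z) := by
    rw [Complex.mul_conj, Complex.normSq_eq_norm_sq]
  have hreal : ((inner ℝ (w z) (z * w') : ℝ) : ℂ) = z * w' * conj (w z) := by
    apply Complex.ext
    · simp [Complex.inner]
    · rw [Complex.inner, Complex.mul_re] at angular
      simp at angular ⊢
      linarith
  have hc : conj (w z) ≠ 0 := by simpa using hwz
  rw [Complex.ofReal_div, hreal, hsq]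
  field_simp

/-- If `‖u‖ ≥ 1` and `u ≠ 1`, then `Re (u / (1 - u)) ≤ -1/2`. -/
theorem re_div_one_sub_le {u : ℂ} (hu : 1 ≤ ‖u‖) (hu1 : u ≠ 1) : (u / (1 - u)).re ≤ -(1 / 2) := by
  have hne : 0 < Complex.normSq (1 - u) := Complex.normSq_pos.2 (sub_ne_zero.2 hu1.symm)
  have h1 : 1 ≤ Complex.normSq u := by
    rw [Complex.normSq_eq_norm_sq]; nlinarith
  rw [Complex.div_re, ← add_div, div_le_iff₀ hne]
  simp only [Complex.normSq_apply, Complex.sub_re, Complex.sub_im, Complex.one_re,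
    Complex.one_im] at *
  nlinarith

open Metric in
/-- If `l` is holomorphic in the unit disk with `l 0 = 0` and `Re (z l'(z)) < 1/2`, then
`‖exp (l z) - 1‖ ≤ ‖z‖`. -/
theorem norm_exp_sub_one_le {l : ℂ → ℂ} {l' : ℂ → ℂ}
    (hl : ∀ z ∈ ball (0 : ℂ) 1, HasDerivAt l (l' z) z) (hl0 : l 0 = 0)
    (hre : ∀ z ∈ ball (0 : ℂ) 1, (z * l' z).re < 1 / 2) {z : ℂ} (hz : z ∈ ball (0 : ℂ) 1) :
    ‖Complex.exp (l z) - 1‖ ≤ ‖z‖ := by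
  set w : ℂ → ℂ := fun z => 1 - Complex.exp (l z) with hw
  have hwd : ∀ z ∈ ball (0 : ℂ) 1, HasDerivAt w (-(Complex.exp (l z) * l' z)) z :=
    fun z hz => (hl z hz).cexp.const_sub 1
  have hdw : DifferentiableOn ℂ w (ball 0 1) :=
    fun z hz => (hwd z hz).differentiableAt.differentiableWithinAt
  have hw0 : w 0 = 0 := by simp [hw, hl0]
  have hlt : ∀ x ∈ ball (0 : ℂ) 1, ‖w x‖ < 1 := by
    intro x hx
    by_contra! hcon
    have hx0 : x ≠ 0 := by
      rintro rfl
      rw [hw0, norm_zero] at hcon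
      linarith
    have hxpos : 0 < ‖x‖ := norm_pos_iff.2 hx0
    have hx1 : ‖x‖ < 1 := mem_ball_zero_iff.1 hx
    obtain ⟨y, hy, hymax⟩ := Complex.exists_mem_frontier_isMaxOn_norm (f := w)
      (isBounded_ball (x := (0 : ℂ)) (r := ‖x‖)) (nonempty_ball.2 hxpos)
      (by
        apply DifferentiableOn.diffContOnCl
        rw [closure_ball _ hxpos.ne']
        exact hdw.mono (closedBall_subset_ball hx1))
    rw [frontier_ball _ hxpos.ne', mem_sphere_zero_iff_norm] at hy
    rw [closure_ball _ hxpos.ne', ← hy] at hymax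
    have hyb : y ∈ ball (0 : ℂ) 1 := by rw [mem_ball_zero_iff, hy]; exact hx1
    have hwy : 1 ≤ ‖w y‖ := hcon.trans (hymax (by simp [hy]))
    obtain ⟨m, hm, hmw⟩ := jack_lemma (hdw.mono (ball_subset_ball (mem_ball_zero_iff.1 hyb).le))
      (hwd y hyb) hw0 (norm_pos_iff.1 (by linarith)) (fun x hx => hymax hx)
    have hne : w y ≠ 1 := by simp [hw]
    have key := re_div_one_sub_le hwy hne
    have hexp : Complex.exp (l y) = 1 - w y := by simp [hw]
    have hsub : 1 - w y ≠ 0 := sub_ne_zero.2 hne.symm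
    -- With `m ≥ 1` and `Re (w / (1 - w)) ≤ -1/2`, this forces `Re (y l'(y)) ≥ 1/2`, a
    -- contradiction.
    have heq : y * l' y = ((-m : ℝ) : ℂ) * (w y / (1 - w y)) := by
      rw [hexp] at hmw
      push_cast
      field_simp
      linear_combination -hmw
    have := hre y hyb
    rw [heq, Complex.re_ofReal_mul] at this
    nlinarith
  have := Complex.norm_le_norm_of_mapsTo_ball hdw
    (fun x hx => mem_closedBall_zero_iff.2 (hlt x hx).le) hw0 (mem_ball_zero_iff.1 hz)
  rwa [norm_sub_rev]

/-- A point of the disk of radius `r < 1` about `1` has argument at most `π r / 2`. -/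
theorem abs_arg_le_of_norm_sub_one_le {k : ℂ} {r : ℝ} (hr : r < 1) (hk : ‖k - 1‖ ≤ r) :
    |Complex.arg k| ≤ Real.pi / 2 * r := by
  have hre : 0 < k.re := by
    have := (abs_le.1 (Complex.abs_re_le_norm (k - 1))).1
    simp at this
    linarith
  have harg : |Complex.arg k| < Real.pi / 2 := Complex.abs_arg_lt_pi_div_two_iff.2 (Or.inl hre)
  have h1 := Real.mul_le_sin (abs_nonneg _) harg.le
  have hk0 : 0 < ‖k‖ := norm_pos_iff.2 (by rintro rfl; simp at hre)
  have hn : ‖k‖ ^ 2 = k.re ^ 2 + k.im ^ 2 := by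
    rw [← Complex.normSq_eq_norm_sq, Complex.normSq_apply]; ring
  have hsq : ‖k - 1‖ ^ 2 = (k.re - 1) ^ 2 + k.im ^ 2 := by
    rw [← Complex.normSq_eq_norm_sq, Complex.normSq_apply]; simp; ring
  have hsin : Real.sin |Complex.arg k| ≤ r := by
    have h2 : Real.sin |Complex.arg k| ≤ |k.im / ‖k‖| := by
      rw [← Complex.sin_arg]
      rcases abs_choice (Complex.arg k) with h | h <;> rw [h]
      · exact le_abs_self _
      · rw [Real.sin_neg]; exact neg_le_abs _
    refine (h2.trans (abs_le_of_sq_le_sq ?_ (norm_nonneg _))).trans hk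
    rw [div_pow, div_le_iff₀ (by positivity), hsq, hn]
    -- `‖k - 1‖² ‖k‖² - (Im k)² = (‖k‖² - Re k)²`.
    nlinarith [sq_nonneg (k.re ^ 2 + k.im ^ 2 - k.re)]
  have hpi := Real.pi_pos
  calc _ = Real.pi / 2 * (2 / Real.pi * |Complex.arg k|) := by field_simp
    _ ≤ _ := by gcongr; exact h1.trans hsin

open Metric in
/-- For `h ∈ ℱ(α)` the derivative has a holomorphic logarithm `L` with `|Im L(z)| ≤ α π |z| / 2`. -/
theorem ClassF.exists_log_deriv {α : ℝ} (hα : 0 < α) {h : ℂ → ℂ} (hh : ClassF α h) {z : ℂ}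
    (hz : z ∈ unitDisk) :
    ∃ L : ℂ, deriv h z = Complex.exp L ∧ |L.im| ≤ α * (Real.pi / 2 * ‖z‖) := by
  have hopen : IsOpen (ball (0 : ℂ) 1) := isOpen_ball
  have hpre : IsPreconnected (ball (0 : ℂ) 1) := (convex_ball _ _).isPreconnected
  have h0 : (0 : ℂ) ∈ ball (0 : ℂ) 1 := by simp
  have hd1 : AnalyticOnNhd ℂ (deriv h) (ball 0 1) := hh.classA.analytic.deriv
  have hquot : DifferentiableOn ℂ (fun z => deriv (deriv h) z / deriv h z) (ball 0 1) :=
    hd1.deriv.differentiableOn.div hd1.differentiableOn hh.deriv_ne_zero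
  obtain ⟨L, hL0, hL⟩ := hquot.isExactOn_ball.with_val_at 0 0
  have hexp : ∀ z ∈ ball (0 : ℂ) 1, deriv h z = Complex.exp (L z) := by
    have hder : ∀ z ∈ ball (0 : ℂ) 1,
        HasDerivAt (fun z => deriv h z * Complex.exp (-L z)) 0 z := by
      intro z hz
      refine ((hd1 z hz).differentiableAt.hasDerivAt.mul (hL z hz).neg.cexp).congr_deriv ?_
      have := hh.deriv_ne_zero z hz
      field_simp
      ring
    intro z hz
    have := hopen.is_const_of_deriv_eq_zero hpre
      (fun z hz => (hder z hz).differentiableAt.differentiableWithinAt)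
      (fun z hz => (hder z hz).deriv) hz h0
    simp only [hL0, hh.classA.deriv_zero, neg_zero, Complex.exp_zero, mul_one,
      Complex.exp_neg] at this
    exact (mul_inv_eq_one₀ (Complex.exp_ne_zero _)).1 this
  have hαC : (α : ℂ) ≠ 0 := by exact_mod_cast hα.ne'
  have hl : ∀ z ∈ ball (0 : ℂ) 1, HasDerivAt (fun z => ((-α⁻¹ : ℝ) : ℂ) * L z)
      (((-α⁻¹ : ℝ) : ℂ) * (deriv (deriv h) z / deriv h z)) z :=
    fun z hz => (hL z hz).const_mul _
  have hbound : ∀ z ∈ ball (0 : ℂ) 1,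
      ‖Complex.exp (((-α⁻¹ : ℝ) : ℂ) * L z) - 1‖ ≤ ‖z‖ := by
    intro z hz
    refine norm_exp_sub_one_le hl (by simp [hL0]) (fun z hz => ?_) hz
    have hre := hh.re_gt z hz
    rw [Complex.add_re, Complex.one_re, mul_div_assoc] at hre
    rw [mul_left_comm, Complex.re_ofReal_mul, neg_mul, ← div_eq_inv_mul, ← neg_div,
      div_lt_iff₀ hα]
    linarith
  have hslit : ∀ z ∈ ball (0 : ℂ) 1,
      Complex.exp (((-α⁻¹ : ℝ) : ℂ) * L z) ∈ Complex.slitPlane := by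
    intro z hz
    left
    have h1 := (abs_le.1 (Complex.abs_re_le_norm (Complex.exp (((-α⁻¹ : ℝ) : ℂ) * L z) - 1))).1
    have h2 := hbound z hz
    have h3 := mem_ball_zero_iff.1 hz
    rw [Complex.sub_re, Complex.one_re] at h1
    linarith
  -- The principal logarithm of `exp l` is `l` itself: derivatives agree and both vanish at `0`. So
  -- `Im l` is a genuine argument.
  have hlog := hopen.eqOn_of_deriv_eq (𝕜 := ℂ)
    (f := fun z => Complex.log (Complex.exp (((-α⁻¹ : ℝ) : ℂ) * L z)))
    (g := fun z => ((-α⁻¹ : ℝ) : ℂ) * L z) hpre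
    (fun z hz => ((hl z hz).cexp.clog (hslit z hz)).differentiableAt.differentiableWithinAt)
    (fun z hz => (hl z hz).differentiableAt.differentiableWithinAt)
    (fun z hz => by
      rw [((hl z hz).cexp.clog (hslit z hz)).deriv, (hl z hz).deriv]
      exact mul_div_cancel_left₀ _ (Complex.exp_ne_zero _))
    h0 (by simp [hL0]) hz
  refine ⟨L z, hexp z hz, ?_⟩
  have harg := abs_arg_le_of_norm_sub_one_le (mem_ball_zero_iff.1 hz) (hbound z hz)
  rw [← Complex.log_im] at harg
  simp only at hlog
  rw [hlog, Complex.im_ofReal_mul, abs_mul, abs_neg, abs_inv, abs_of_pos hα,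
    inv_mul_le_iff₀ hα] at harg
  exact harg

/-- If `Re h' > |g'|` in the disk, then `h + conj g` is injective there. -/
theorem univalentInDisk_of_norm_deriv_lt_re {h g : ℂ → ℂ} (hh : AnalyticOnNhd ℂ h unitDisk)
    (hg : AnalyticOnNhd ℂ g unitDisk) (hlt : ∀ z ∈ unitDisk, ‖deriv g z‖ < (deriv h z).re) :
    UnivalentInDisk (harmonicMap h g) := by
  intro a ha b hb hab
  by_contra hne
  set d := b - a with hd
  have hd0 : d ≠ 0 := sub_ne_zero.2 (Ne.symm hne)
  have hmem : ∀ t ∈ Set.Icc (0 : ℝ) 1, a + t * d ∈ unitDisk := by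
    intro t ht
    have := (convex_ball (0 : ℂ) 1).add_smul_sub_mem ha hb ht
    simpa [unitDisk] using this
  -- Since `Re (d g) = Re (conj d * conj g)`, this is `Re (conj d * f)` along the segment, written
  -- through holomorphic functions.
  set u : ℝ → ℝ := fun t => (conj d * h (a + t * d) + d * g (a + t * d)).re with hu
  have hder : ∀ t ∈ Set.Icc (0 : ℝ) 1, HasDerivAt u
      (conj d * (deriv h (a + t * d) * d) + d * (deriv g (a + t * d) * d)).re t := by
    intro t ht
    have hline : HasDerivAt (fun s : ℂ => a + s * d) d t := by
      simpa using ((hasDerivAt_id (t : ℂ)).mul_const d).const_add a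
    have h1 := ((hh _ (hmem t ht)).differentiableAt.hasDerivAt.comp (t : ℂ) hline).const_mul (conj d)
    have h2 := ((hg _ (hmem t ht)).differentiableAt.hasDerivAt.comp (t : ℂ) hline).const_mul d
    exact (h1.add h2).real_of_complex
  have hmono : StrictMonoOn u (Set.Icc 0 1) := by
    refine strictMonoOn_of_deriv_pos (convex_Icc 0 1)
      (fun t ht => (hder t ht).continuousAt.continuousWithinAt) fun t ht => ?_
    have ht' := interior_subset ht
    rw [(hder t ht').deriv, Complex.add_re]
    have hpos : 0 < ‖d‖ ^ 2 := by positivity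
    have h1 : (conj d * (deriv h (a + t * d) * d)).re = ‖d‖ ^ 2 * (deriv h (a + t * d)).re := by
      rw [← Complex.re_ofReal_mul, ← Complex.normSq_eq_norm_sq, Complex.normSq_eq_conj_mul_self]
      ring_nf
    have h2 : -(‖d‖ ^ 2 * ‖deriv g (a + t * d)‖) ≤ (d * (deriv g (a + t * d) * d)).re := by
      have := (abs_le.1 (Complex.abs_re_le_norm (d * (deriv g (a + t * d) * d)))).1
      rw [norm_mul, norm_mul] at this
      linarith
    nlinarith [hlt _ (hmem t ht')]
  have hlt01 := hmono (by simp : (0 : ℝ) ∈ Set.Icc (0 : ℝ) 1) (by simp) one_pos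
  have hval : ∀ z, (conj d * h z + d * g z).re = (conj d * harmonicMap h g z).re := by
    intro z
    simp [harmonicMap]
    ring
  simp only [hu, hval] at hlt01
  simp [hd] at hlt01
  rw [hab] at hlt01
  exact lt_irrefl _ hlt01

theorem mainTheorem7 (α : ℝ) (hα : α ∈ Set.Ioo (0 : ℝ) (1 / 2)) (h g : ℂ → ℂ)
    (hh : ClassF α h) (hg : AnalyticOnNhd ℂ g unitDisk)
    (hsp : SensePreserving h g)
    (hω : ∀ z ∈ unitDisk, ‖dilatation h g z‖ ≤ 1 - α * ‖z‖ * (1 + ‖z‖)) :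
    UnivalentInDisk (harmonicMap h g) := by
  obtain ⟨hα0, hα1⟩ := hα
  refine univalentInDisk_of_norm_deriv_lt_re hh.classA.analytic hg fun z hz => ?_
  rcases eq_or_ne z 0 with rfl | hz0
  -- At `0` the dilatation bound is only `≤ 1`; strictness comes from the Jacobian.
  · have := hsp 0 hz
    rw [harmonicJacobian, hh.classA.deriv_zero] at this
    rw [hh.classA.deriv_zero, Complex.one_re]
    rw [norm_one] at this
    nlinarith [norm_nonneg (deriv g 0)]
  obtain ⟨L, hL, him⟩ := hh.exists_log_deriv hα0 hz
  have hr : 0 < ‖z‖ := norm_pos_iff.2 hz0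
  have hpos : 0 < ‖deriv h z‖ := norm_pos_iff.2 (hh.deriv_ne_zero z hz)
  have hg' : ‖deriv g z‖ ≤ (1 - α * ‖z‖ * (1 + ‖z‖)) * ‖deriv h z‖ := by
    have := hω z hz
    rwa [dilatation, norm_div, div_le_iff₀ hpos] at this
  have hre : (deriv h z).re = Real.cos L.im * ‖deriv h z‖ := by
    rw [hL, Complex.exp_re, Complex.norm_exp, mul_comm]
  rw [hre]
  refine hg'.trans_lt (mul_lt_mul_of_pos_right ?_ hpos)
  have hcos := Real.one_sub_sq_div_two_le_cos (x := L.im)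
  -- The crude `π ≤ 4` suffices: it gives `cos (Im L) ≥ 1 - 2 α² |z|²`, and `2 α < 1` does the rest.
  have hb : α * (Real.pi / 2 * ‖z‖) ≤ α * (2 * ‖z‖) := by
    have := Real.pi_le_four
    gcongr
    linarith
  have hsq : L.im ^ 2 ≤ (α * (2 * ‖z‖)) ^ 2 := sq_le_sq' (by linarith [(abs_le.1 (him.trans hb)).1])
    (abs_le.1 (him.trans hb)).2
  have hstrict : α * (α * ‖z‖ ^ 2 * 2) < α * (‖z‖ * (1 + ‖z‖)) := by
    refine mul_lt_mul_of_pos_left ?_ hα0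
    nlinarith [mul_pos hr hr]
  nlinarith
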